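/- Let $M$ be a nonempty compact (Hausdorff) manifold of class $C^1$ (in particular, possibly $C^\infty$) and dimension $n\ge 1$, possibly with boundary or corners, equipped with a continuous Riemannian metric $\|\cdot\|$, and let $m$ be its normalized Lebesgue measure, i.e. the Riemannian volume divided by its total mass. Let $f_1,\dots,f_d$ be $C^1$ maps of $M$ to itself that are local diffeomorphisms, and let $\Gamma$ be the semigroup they generate. For $\omega=\omega_1\omega_2\dots\in\{1,\dots,d\}^{\mathbb N}$ write $f^0_\omega=\mathrm{id}$ and $f^k_\omega=f_{\omega_k}\circ\dots\circ f_{\omega_1}$ for $k\ge1$. The action of $\Gamma$ on $M$ is called \emph{non-uniformly expanding (along an orbital branch)} if there is $\omega\in\{1,\dots,d\}^{\mathbb N}$ such that for $m$-almost every $x\in M$ $$\limsup_{k\to\infty}\frac1k\sum_{i=0}^{k-1}\log\big\|Df_{\omega_{i+1}}(f^i_\omega(x))^{-1}\big\|<0,$$ where $\|\cdot\|$ is the operator norm induced by the Riemannian metric. \textbf{Proposition.} There are no non-uniformly expanding finitely generated semigroup actions of diffeomorphisms: if $f_1,\dots,f_d$ are $C^1$ diffeomorphisms of $M$ (onto $M$),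 then the action of the semigroup generated by $f_1,\dots,f_d$ on $M$ is not non-uniformly expanding along an orbital branch. -/

import Mathlib

open Set Filter Topology MeasureTheory Bundle
open scoped Manifold ENNReal

noncomputable section

/-- The coordinate density `√(det (gᵢⱼ(y)))` of a Riemannian metric in the preferred chart `φ` around
`p`, at a point `y` of the chart image: `gᵢⱼ(y)` is the inner product of the coordinate vectors
`D(φ⁻¹)(y) eᵢ` and `D(φ⁻¹)(y) eⱼ` at `φ⁻¹(y)`. -/
def chartDensity {n : ℕ} {H : Type*} [TopologicalSpace H]
    (I : ModelWithCorners ℝ (EuclideanSpace ℝ (Fin n)) H)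
    {M : Type*} [TopologicalSpace M] [ChartedSpace H M]
    [RiemannianBundle (fun x : M => TangentSpace I x)]
    (p : M) (y : EuclideanSpace ℝ (Fin n)) : ℝ≥0∞ :=
  ENNReal.ofReal (Real.sqrt (Matrix.det (Matrix.of fun i j : Fin n =>
    inner ℝ
      (mfderiv[range I] (extChartAt I p).symm y (EuclideanSpace.single i (1 : ℝ)) :
        TangentSpace I ((extChartAt I p).symm y))
      (mfderiv[range I] (extChartAt I p).symm y (EuclideanSpace.single j (1 : ℝ)) :
        TangentSpace I ((extChartAt I p).symm y)))))

/-- The Riemannian volume of the domain of the preferred chart around `p`, extended by zero to the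
whole manifold: the measure `√(det g) dy` on the chart image, transported by the inverse chart. -/
def chartVolume {n : ℕ} {H : Type*} [TopologicalSpace H]
    (I : ModelWithCorners ℝ (EuclideanSpace ℝ (Fin n)) H)
    {M : Type*} [TopologicalSpace M] [ChartedSpace H M]
    [RiemannianBundle (fun x : M => TangentSpace I x)] [MeasurableSpace M]
    (p : M) : Measure M :=
  Measure.map (extChartAt I p).symm
    ((volume.restrict (extChartAt I p).target).withDensity (chartDensity I p))

/-- The Riemannian volume measure. The measures `chartVolume I p` agree on overlaps of chart domains
(by the change of variables formula), and the supremum, in the complete lattice of measures, is the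
measure that restricts to `chartVolume I p` on each chart domain. -/
def riemannianVolume {n : ℕ} {H : Type*} [TopologicalSpace H]
    (I : ModelWithCorners ℝ (EuclideanSpace ℝ (Fin n)) H)
    (M : Type*) [TopologicalSpace M] [ChartedSpace H M]
    [RiemannianBundle (fun x : M => TangentSpace I x)] [MeasurableSpace M] : Measure M :=
  ⨆ p : M, chartVolume I p

/-- The normalized Lebesgue measure `m` of a compact Riemannian manifold. -/
def normalizedLebesgue {n : ℕ} {H : Type*} [TopologicalSpace H]
    (I : ModelWithCorners ℝ (EuclideanSpace ℝ (Fin n)) H)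
    (M : Type*) [TopologicalSpace M] [ChartedSpace H M]
    [RiemannianBundle (fun x : M => TangentSpace I x)] [MeasurableSpace M] : Measure M :=
  (riemannianVolume I M univ)⁻¹ • riemannianVolume I M

/-- The orbital branch `f^k_ω = f_{ω_k} ∘ ⋯ ∘ f_{ω_1}`, with `f^0_ω = id`. The sequence `ω` is indexed
from zero: `ω i` is the letter `ω_{i+1}`. -/
def orbitalBranch {M : Type*} {d : ℕ} (f : Fin d → M → M) (ω : ℕ → Fin d) : ℕ → M → M
  | 0 => id
  | k + 1 => f (ω k) ∘ orbitalBranch f ω k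

/-- The action on `M` of the semigroup generated by `f₁, …, f_d` is non-uniformly expanding along an
orbital branch: there is one sequence `ω` with
`limsup (1/k) ∑_{i<k} log ‖Df_{ω_{i+1}}(f^i_ω(x))⁻¹‖ < 0` for Lebesgue almost every `x`.
Norms are those of the Riemannian metric; the upper limit is taken in the extended reals. -/
def IsNonUniformlyExpanding {n : ℕ} {H : Type*} [TopologicalSpace H]
    (I : ModelWithCorners ℝ (EuclideanSpace ℝ (Fin n)) H)
    {M : Type*} [TopologicalSpace M] [ChartedSpace H M]
    [RiemannianBundle (fun x : M => TangentSpace I x)] [MeasurableSpace M]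
    {d : ℕ} (f : Fin d → M → M) : Prop :=
  ∃ ω : ℕ → Fin d, ∀ᵐ x ∂(normalizedLebesgue I M),
    limsup (fun k : ℕ => (((1 / (k : ℝ)) * ∑ i ∈ Finset.range k,
      Real.log ‖(mfderiv I I (f (ω i)) (orbitalBranch f ω i x)).inverse‖ : ℝ) : EReal)) atTop < 0

end

set_option linter.unusedSectionVars false

/-! A diffeomorphism cannot increase total volume. Its Jacobian at `x` is at least `‖Dφ(x)⁻¹‖⁻ⁿ`
(`expansionBound`), so change of variables, where injectivity is essential, gives `∫ expansionBound
φ * (h ∘ φ) ≤ ∫ h` (`lintegral_expansionBound_mul_le`). Iterating along the branch, the product of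
these bounds over the first `k` steps has integral at most `vol M`, for every `k`
(`lintegral_prod_expansionBound_mul_le`). Non-uniform expansion forces the products to tend to
infinity almost everywhere. As `0 < vol M < ∞`, this contradicts Fatou's lemma. -/

/-- `L` scales Hausdorff measure of dimension `finrank U` by exactly `normDet`, and by at most `‖L‖
^ finrank U` because it is `‖L‖`-Lipschitz; the unit ball compares the two. -/
theorem ContinuousLinearMap.normDet_le_norm_pow {U V : Type*} [NormedAddCommGroup U]
    [InnerProductSpace ℝ U] [FiniteDimensional ℝ U] [NormedAddCommGroup V] [InnerProductSpace ℝ V]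
    (L : U →L[ℝ] V) :
    (L : U →ₗ[ℝ] V).normDet ≤ ‖L‖ ^ Module.finrank ℝ U := by
  borelize U V
  have h1 := (L : U →ₗ[ℝ] V).euclideanHausdorffMeasure_image_eq_normDet_mul_volume
    (Metric.closedBall 0 1)
  have h2 := L.lipschitz.hausdorffMeasure_image_le (d := Module.finrank ℝ U) (by positivity)
    (Metric.closedBall 0 1)
  have h3 : ENNReal.ofReal (L : U →ₗ[ℝ] V).normDet * volume (Metric.closedBall (0 : U) 1) ≤
      ENNReal.ofReal (‖L‖ ^ Module.finrank ℝ U) * volume (Metric.closedBall (0 : U) 1) := by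
    rw [← h1, ← InnerProductSpace.euclideanHausdorffMeasure_eq_volume,
      Measure.euclideanHausdorffMeasure_def, Measure.euclideanHausdorffMeasure_def,
      Measure.smul_apply, Measure.smul_apply, mul_smul_comm]
    gcongr
    refine h2.trans_eq ?_
    rw [ENNReal.rpow_natCast, ENNReal.ofReal_pow (norm_nonneg _), ofReal_norm]
    rfl
  rw [ENNReal.mul_le_mul_iff_left (Metric.measure_closedBall_pos _ _ one_pos).ne'
    measure_closedBall_lt_top.ne] at h3
  exact (ENNReal.ofReal_le_ofReal_iff (by positivity)).1 h3

/-! ### Jacobians and chart densities on tangent spaces -/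

section TangentMaps

variable {n : ℕ} {H : Type*} [TopologicalSpace H]
    {I : ModelWithCorners ℝ (EuclideanSpace ℝ (Fin n)) H}
    {M : Type*} [TopologicalSpace M]
    [ChartedSpace H M]
    [RiemannianBundle (fun x : M => TangentSpace I x)]

instance finiteDimensional_tangentSpace (x : M) : FiniteDimensional ℝ (TangentSpace I x) :=
  inferInstanceAs (FiniteDimensional ℝ (EuclideanSpace ℝ (Fin n)))

theorem finrank_tangentSpace (x : M) : Module.finrank ℝ (TangentSpace I x) = n :=
  (finrank_euclideanSpace_fin (𝕜 := ℝ) : Module.finrank ℝ (EuclideanSpace ℝ (Fin n)) = n)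

variable (I) in
/-- The derivative of the inverse of the preferred chart around `p`. -/
noncomputable def chartFrame (p : M) (y : EuclideanSpace ℝ (Fin n)) :
    EuclideanSpace ℝ (Fin n) →L[ℝ] TangentSpace I ((extChartAt I p).symm y) :=
  mfderiv[range I] (extChartAt I p).symm y

variable (I) in
/-- The derivative of the preferred chart around `p`. -/
noncomputable def chartCoframe (p x : M) :
    TangentSpace I x →L[ℝ] EuclideanSpace ℝ (Fin n) :=
  mfderiv I 𝓘(ℝ, EuclideanSpace ℝ (Fin n)) (extChartAt I p) x

/-- A Gram determinant is the square of `normDet`. In this form densities can be handled by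
multiplicativity. -/
theorem chartDensity_eq_normDet (p : M) (y : EuclideanSpace ℝ (Fin n)) :
    chartDensity I p y = ENNReal.ofReal (chartFrame I p y).toLinearMap.normDet := by
  have h := (chartFrame I p y).toLinearMap.normDet_sq_eq_det_gram
    (EuclideanSpace.basisFun (Fin n) ℝ)
  rw [chartDensity, ← Real.sqrt_sq (LinearMap.normDet_nonneg _)]
  congr 2
  refine Eq.trans ?_ h.symm
  congr 1
  ext i j
  simp only [Matrix.of_apply, Matrix.gram_apply, EuclideanSpace.basisFun_apply]
  rfl

variable [IsManifold I 1 M]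

theorem chartCoframe_comp_chartFrame (p : M) {y : EuclideanSpace ℝ (Fin n)}
    (hy : y ∈ (extChartAt I p).target) :
    (chartCoframe I p ((extChartAt I p).symm y)).toLinearMap ∘ₗ (chartFrame I p y).toLinearMap
      = LinearMap.id := by
  have := mfderiv_extChartAt_comp_mfderivWithin_extChartAt_symm hy
  ext1 v
  exact congrArg (fun L : EuclideanSpace ℝ (Fin n) →L[ℝ] EuclideanSpace ℝ (Fin n) => L v) this

theorem normDet_chartCoframe_mul_normDet_chartFrame (p : M) {y : EuclideanSpace ℝ (Fin n)}
    (hy : y ∈ (extChartAt I p).target) :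
    (chartCoframe I p ((extChartAt I p).symm y)).toLinearMap.normDet *
      (chartFrame I p y).toLinearMap.normDet = 1 := by
  rw [← LinearMap.normDet_comp_of_finrank_eq _ _ (by rw [finrank_tangentSpace]; simp),
    chartCoframe_comp_chartFrame p hy, LinearMap.normDet_id]

theorem one_le_normDet_mfderiv_mul (φ : M ≃ₘ^1⟮I, I⟯ M) (x : M) :
    1 ≤ (mfderiv I I φ x).toLinearMap.normDet * ‖(mfderiv I I φ x).inverse‖ ^ n := by
  let D := φ.mfderivToContinuousLinearEquiv one_ne_zero x
  have hD : mfderiv I I φ x = D := rfl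
  have h1 : (D.symm : TangentSpace I (φ x) →L[ℝ] TangentSpace I x).toLinearMap.normDet *
      (D : TangentSpace I x →L[ℝ] TangentSpace I (φ x)).toLinearMap.normDet = 1 := by
    rw [← LinearMap.normDet_comp_of_finrank_eq _ _ (by simp only [finrank_tangentSpace])]
    have : (D.symm : TangentSpace I (φ x) →L[ℝ] TangentSpace I x).toLinearMap ∘ₗ
      (D : TangentSpace I x →L[ℝ] TangentSpace I (φ x)).toLinearMap = LinearMap.id := by
      ext1 v; exact D.symm_apply_apply v
    rw [this, LinearMap.normDet_id]
  have h2 := (D.symm : TangentSpace I (φ x) →L[ℝ] TangentSpace I x).normDet_le_norm_pow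
  rw [finrank_tangentSpace] at h2
  rw [hD, ContinuousLinearMap.inverse_equiv, ← h1, mul_comm]
  gcongr
  exact LinearMap.normDet_nonneg _

/-- The lower bound `‖Dφ(x)⁻¹‖⁻ⁿ` for the Jacobian of `φ` at `x`. -/
noncomputable def expansionBound (φ : M ≃ₘ^1⟮I, I⟯ M) (x : M) : ℝ≥0∞ :=
  ENNReal.ofReal (Real.exp (-(n * Real.log ‖(mfderiv I I φ x).inverse‖)))

theorem expansionBound_le_normDet (φ : M ≃ₘ^1⟮I, I⟯ M) (x : M) :
    expansionBound φ x ≤ ENNReal.ofReal (mfderiv I I φ x).toLinearMap.normDet := by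
  have h := one_le_normDet_mfderiv_mul φ x
  apply ENNReal.ofReal_le_ofReal
  have h3 : Real.exp (n * Real.log ‖(mfderiv I I φ x).inverse‖) =
      ‖(mfderiv I I φ x).inverse‖ ^ n := by
    rw [mul_comm, Real.exp_mul, Real.rpow_natCast]
    -- In dimension 0 both sides are 1, whatever the logarithm. Otherwise `h` excludes norm zero.
    rcases eq_or_ne n 0 with rfl | hn
    · simp
    · rw [Real.exp_log]
      refine lt_of_le_of_ne (ContinuousLinearMap.opNorm_nonneg _) fun h0 => ?_
      rw [← h0, zero_pow hn, mul_zero] at h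
      linarith
  rw [Real.exp_neg, h3]
  have h4 : 0 < ‖(mfderiv I I φ x).inverse‖ ^ n := h3 ▸ Real.exp_pos _
  rwa [inv_eq_one_div, div_le_iff₀ h4]

end TangentMaps

theorem ContinuousOn.measurableSet_inter_preimage {α β : Type*} [TopologicalSpace α]
    [MeasurableSpace α] [OpensMeasurableSpace α] [TopologicalSpace β] [MeasurableSpace β]
    [BorelSpace β] {g : α → β} {s : Set α} {t : Set β} (hg : ContinuousOn g s)
    (hs : MeasurableSet s) (ht : MeasurableSet t) : MeasurableSet (s ∩ g ⁻¹' t) := by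
  have h := (MeasurableEmbedding.subtype_coe hs).measurableSet_image.2
    ((continuousOn_iff_continuous_domRestrict.1 hg).measurable ht)
  convert! h using 1
  ext x
  simp [and_comm]

/-! ### Chart expressions, continuity and measurability -/

section Charts

variable {n : ℕ} {H : Type*} [TopologicalSpace H]
    {I : ModelWithCorners ℝ (EuclideanSpace ℝ (Fin n)) H}
    {M : Type*} [TopologicalSpace M]
    [ChartedSpace H M]

theorem measurableSet_extChartAt_target (p : M) : MeasurableSet (extChartAt I p).target := by
  rw [extChartAt_target]
  exact ((chartAt H p).open_target.preimage I.continuous_symm).measurableSet.inter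
    I.isClosed_range.measurableSet

variable [IsManifold I 1 M]

theorem continuousOn_chartFrame_apply (p : M) (v : EuclideanSpace ℝ (Fin n)) :
    ContinuousOn (fun y => (⟨(extChartAt I p).symm y, chartFrame I p y v⟩ : TangentBundle I M))
      (extChartAt I p).target := by
  have h := (contMDiffOn_extChartAt_symm (I := I) (n := 1) p).continuousOn_tangentMapWithin le_rfl
    (uniqueMDiffOn_iff_uniqueDiffOn.2 (uniqueDiffOn_extChartAt_target p))
  have hc : Continuous (fun y => (⟨y, v⟩ :
      TangentBundle 𝓘(ℝ, EuclideanSpace ℝ (Fin n)) (EuclideanSpace ℝ (Fin n)))) := by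
    have := (tangentBundleModelSpaceHomeomorph 𝓘(ℝ, EuclideanSpace ℝ (Fin n))).symm.continuous.comp
      (Continuous.prodMk continuous_id (continuous_const (y := v)))
    exact this
  have h2 := h.comp (s := (extChartAt I p).target) hc.continuousOn (fun y hy => hy)
  refine h2.congr fun y hy => ?_
  -- Near `y` the target agrees with `range I`, so the derivatives within the two sets coincide.
  have : mfderiv[(extChartAt I p).target] (extChartAt I p).symm y = chartFrame I p y :=
    mfderivWithin_congr_set (extChartAt_target_eventuallyEq_of_mem hy)
  simp only [Function.comp_def, tangentMapWithin, this]
  rfl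

variable [RiemannianBundle (fun x : M => TangentSpace I x)]

theorem hasFDerivWithinAt_chart_read (φ : M ≃ₘ^1⟮I, I⟯ M) {p q : M}
    {y : EuclideanSpace ℝ (Fin n)} (hy : y ∈ (extChartAt I p).target)
    (hq : φ ((extChartAt I p).symm y) ∈ (extChartAt I q).source) :
    HasFDerivWithinAt (fun y => extChartAt I q (φ ((extChartAt I p).symm y)))
      (chartCoframe I q (φ ((extChartAt I p).symm y)) ∘L
        mfderiv I I φ ((extChartAt I p).symm y) ∘L chartFrame I p y) (range I) y := by
  have h1 := (mdifferentiableWithinAt_extChartAt_symm (I := I) hy).hasMFDerivWithinAt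
  have h2 := (φ.mdifferentiable one_ne_zero ((extChartAt I p).symm y)).hasMFDerivAt
  have h3 := (mdifferentiableAt_extChartAt (I := I) (extChartAt_source I q ▸ hq)).hasMFDerivAt
  exact (h3.comp_hasMFDerivWithinAt y
    (h2.comp_hasMFDerivWithinAt y h1)).hasFDerivWithinAt

/-- The determinant factors as coframe at `q`, `Dφ`, frame at `p`. The coframe factor cancels the
density at `q`, which leaves the bound on the Jacobian of `φ`. -/
theorem expansionBound_mul_chartDensity_le (φ : M ≃ₘ^1⟮I, I⟯ M) {p q : M}
    {y : EuclideanSpace ℝ (Fin n)}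
    (hq : φ ((extChartAt I p).symm y) ∈ (extChartAt I q).source) :
    expansionBound φ ((extChartAt I p).symm y) * chartDensity I p y ≤
      ENNReal.ofReal |(chartCoframe I q (φ ((extChartAt I p).symm y)) ∘L
        mfderiv I I φ ((extChartAt I p).symm y) ∘L chartFrame I p y).det| *
      chartDensity I q (extChartAt I q (φ ((extChartAt I p).symm y))) := by
  set x := (extChartAt I p).symm y with hx
  have h1 := normDet_chartCoframe_mul_normDet_chartFrame q ((extChartAt I q).map_source hq)
  -- The type of the coframe depends on its base point, so the point is generalized before
  -- rewriting.
  have hz : ∀ z, z = φ x → (chartCoframe I q z).toLinearMap.normDet =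
      (chartCoframe I q (φ x)).toLinearMap.normDet := by
    rintro _ rfl
    rfl
  rw [hz _ ((extChartAt I q).left_inv hq)] at h1
  have h2 : |(chartCoframe I q (φ x) ∘L mfderiv I I φ x ∘L chartFrame I p y).det| =
      (chartCoframe I q (φ x)).toLinearMap.normDet * ((mfderiv I I φ x).toLinearMap.normDet *
        (chartFrame I p y).toLinearMap.normDet) := by
    rw [← LinearMap.normDet_comp_of_finrank_eq _ _ (by simp only [finrank_tangentSpace]; simp),
      ← LinearMap.normDet_comp_of_finrank_eq _ _ (by simp only [finrank_tangentSpace]; simp)]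
    exact (LinearMap.normDet_eq_abs_det _).symm
  rw [chartDensity_eq_normDet, chartDensity_eq_normDet, h2,
    ← ENNReal.ofReal_mul (mul_nonneg (LinearMap.normDet_nonneg _)
      (mul_nonneg (LinearMap.normDet_nonneg _) (LinearMap.normDet_nonneg _)))]
  refine (mul_le_mul_left (expansionBound_le_normDet φ x) _).trans_eq ?_
  rw [← ENNReal.ofReal_mul (LinearMap.normDet_nonneg _)]
  congr 1
  have key : ∀ a b c d : ℝ, a * d = 1 → b * c = a * (b * c) * d :=
    fun a b c d h => by linear_combination (-(b * c)) * h
  exact key _ _ _ _ h1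

variable [IsContinuousRiemannianBundle (EuclideanSpace ℝ (Fin n)) (fun x : M => TangentSpace I x)]

theorem continuousOn_chartDensity (p : M) :
    ContinuousOn (chartDensity I p) (extChartAt I p).target := by
  refine ENNReal.continuous_ofReal.comp_continuousOn (Real.continuous_sqrt.comp_continuousOn ?_)
  refine (Continuous.matrix_det (A := fun A : Matrix (Fin n) (Fin n) ℝ => A)
    continuous_id).comp_continuousOn ?_
  refine continuousOn_pi.2 fun i => continuousOn_pi.2 fun j => ?_
  exact (continuousOn_chartFrame_apply p _).inner_bundle (continuousOn_chartFrame_apply p _)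

/-- For `c ≥ 0`, the norm exceeds `c` exactly when some `v` has `c * ‖Dφ v‖ < ‖v‖`. This persists
nearby once `v` is extended to a local section. Semicontinuity suffices for measurability. -/
theorem lowerSemicontinuous_norm_inverse_mfderiv (φ : M ≃ₘ^1⟮I, I⟯ M) :
    LowerSemicontinuous fun x => ‖(mfderiv I I φ x).inverse‖ := by
  rw [lowerSemicontinuous_iff_isClosed_preimage]
  intro c
  rcases lt_or_ge c 0 with hc | hc
  · convert isClosed_empty
    ext x
    simpa using hc.trans_le (ContinuousLinearMap.opNorm_nonneg _)
  rw [← isOpen_compl_iff, isOpen_iff_mem_nhds]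
  intro x₀ hx₀
  obtain ⟨v₀, hv₀⟩ : ∃ v₀ : TangentSpace I x₀, c * ‖mfderiv I I φ x₀ v₀‖ < ‖v₀‖ := by
    by_contra! h
    apply hx₀
    refine ContinuousLinearMap.opNorm_le_bound _ hc fun w => ?_
    let D := φ.mfderivToContinuousLinearEquiv one_ne_zero x₀
    have hD : mfderiv I I φ x₀ = D := rfl
    have := h (D.symm w)
    rw [hD] at this ⊢
    rw [ContinuousLinearMap.inverse_equiv]
    simpa using this
  have : IsManifold I (0 + 1) M := by simpa
  have hv : ContinuousAt (fun x => (⟨x, FiberBundle.extend (EuclideanSpace ℝ (Fin n)) v₀ x⟩ :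
      TangentBundle I M)) x₀ :=
    (FiberBundle.contMDiffAt_extend (k := 0) I (EuclideanSpace ℝ (Fin n)) v₀).continuousAt
  have hDv := (φ.contMDiff.continuous_tangentMap le_rfl).continuousAt.comp hv
  have h1 := (hv.inner_bundle hv).sqrt
  have h2 := ((ContinuousAt.inner_bundle (b := φ) hDv hDv).sqrt).const_mul c
  simp only [← norm_eq_sqrt_real_inner] at h1 h2
  have h3 := h2.eventually_lt h1 (by simpa using hv₀)
  filter_upwards [h3] with x hx hle
  refine hx.not_ge ?_
  have h4 := (mfderiv I I φ x).inverse.le_opNorm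
    (mfderiv I I φ x (FiberBundle.extend (EuclideanSpace ℝ (Fin n)) v₀ x))
  have h5 : (mfderiv I I φ x).inverse
      (mfderiv I I φ x (FiberBundle.extend (EuclideanSpace ℝ (Fin n)) v₀ x)) =
      FiberBundle.extend (EuclideanSpace ℝ (Fin n)) v₀ x := by
    let D := φ.mfderivToContinuousLinearEquiv one_ne_zero x
    have hD : mfderiv I I φ x = D := rfl
    rw [hD, ContinuousLinearMap.inverse_equiv]
    exact D.symm_apply_apply _
  rw [h5] at h4
  exact h4.trans (mul_le_mul_of_nonneg_right hle (norm_nonneg _))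

theorem measurable_expansionBound [MeasurableSpace M] [BorelSpace M] (φ : M ≃ₘ^1⟮I, I⟯ M) :
    Measurable (expansionBound φ) :=
  (lowerSemicontinuous_norm_inverse_mfderiv φ).measurable.log.const_mul _
    |>.neg.exp.ennreal_ofReal

end Charts

/-! ### Riemannian volume and change of variables -/

section Volume

variable {n : ℕ} {H : Type*} [TopologicalSpace H]
    {I : ModelWithCorners ℝ (EuclideanSpace ℝ (Fin n)) H}
    {M : Type*} [TopologicalSpace M]
    [ChartedSpace H M] [IsManifold I 1 M] [RiemannianBundle (fun x : M => TangentSpace I x)]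
    [IsContinuousRiemannianBundle (EuclideanSpace ℝ (Fin n)) (fun x : M => TangentSpace I x)]
    [MeasurableSpace M] [BorelSpace M]

theorem setLIntegral_chartVolume (p : M) {A : Set M} (hA : MeasurableSet A) {h : M → ℝ≥0∞}
    (hh : Measurable h) :
    ∫⁻ x in A, h x ∂chartVolume I p =
      ∫⁻ y in (extChartAt I p).target ∩ (extChartAt I p).symm ⁻¹' A,
        h ((extChartAt I p).symm y) * chartDensity I p y := by
  have ht := measurableSet_extChartAt_target (I := I) p
  have hs : AEMeasurable (extChartAt I p).symm (volume.restrict (extChartAt I p).target) :=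
    (continuousOn_extChartAt_symm p).aemeasurable ht
  have hs' := hs.mono_ac (withDensity_absolutelyContinuous _ (chartDensity I p))
  have hρ : AEMeasurable (chartDensity I p) (volume.restrict (extChartAt I p).target) :=
    (continuousOn_chartDensity p).aemeasurable ht
  have htA := (continuousOn_extChartAt_symm (I := I) p).measurableSet_inter_preimage ht hA
  have hhA : Measurable (A.indicator h) := hh.indicator hA
  rw [← lintegral_indicator hA, chartVolume, lintegral_map' hhA.aemeasurable hs']
  refine (lintegral_withDensity_eq_lintegral_mul₀ hρ (hhA.comp_aemeasurable hs)).trans ?_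
  rw [← lintegral_indicator ht, ← lintegral_indicator htA]
  congr 1
  ext y
  by_cases h1 : y ∈ (extChartAt I p).target <;>
    by_cases h2 : (extChartAt I p).symm y ∈ A <;>
    simp only [indicator, mem_inter_iff, mem_preimage, Function.comp_apply, h1, h2, Pi.mul_apply,
      if_true, if_false, and_true, and_false, mul_zero, mul_comm]

theorem chartVolume_apply (p : M) {A : Set M} (hA : MeasurableSet A) :
    chartVolume I p A =
      ∫⁻ y in (extChartAt I p).target ∩ (extChartAt I p).symm ⁻¹' A, chartDensity I p y := by
  simpa using setLIntegral_chartVolume (I := I) p hA measurable_one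

theorem chartVolume_inter_source (p : M) {A : Set M} (hA : MeasurableSet A) :
    chartVolume I p (A ∩ (extChartAt I p).source) = chartVolume I p A := by
  rw [chartVolume_apply p hA,
    chartVolume_apply p (hA.inter (isOpen_extChartAt_source p).measurableSet)]
  congr 2
  ext y
  simp only [mem_inter_iff, mem_preimage, and_congr_right_iff, and_iff_left_iff_imp]
  exact fun hy _ => (extChartAt I p).map_target hy

/-- Euclidean change of variables for `φ` read in the charts, which is injective because `φ` is,
combined with the pointwise density bound. -/
theorem setLIntegral_expansionBound_chartVolume_le (φ : M ≃ₘ^1⟮I, I⟯ M) {p q : M} {A : Set M}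
    (hA : MeasurableSet A) (hp : A ⊆ (extChartAt I p).source)
    (hq : A ⊆ φ ⁻¹' (extChartAt I q).source) :
    ∫⁻ x in A, expansionBound φ x ∂chartVolume I p ≤ chartVolume I q (φ '' A) := by
  have hs := (continuousOn_extChartAt_symm (I := I) p).measurableSet_inter_preimage
    (measurableSet_extChartAt_target p) hA
  have hφA : MeasurableSet (φ '' A) :=
    φ.toHomeomorph.measurableEmbedding.measurableSet_image.2 hA
  have himage : (extChartAt I q).target ∩ (extChartAt I q).symm ⁻¹' (φ '' A) =
      (fun y => extChartAt I q (φ ((extChartAt I p).symm y))) ''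
        ((extChartAt I p).target ∩ (extChartAt I p).symm ⁻¹' A) := by
    ext z
    constructor
    · rintro ⟨hz, a, ha, hza⟩
      refine ⟨extChartAt I p a, ⟨(extChartAt I p).map_source (hp ha), ?_⟩, ?_⟩
      · rwa [mem_preimage, (extChartAt I p).left_inv (hp ha)]
      · simp only [(extChartAt I p).left_inv (hp ha), hza, (extChartAt I q).right_inv hz]
    · rintro ⟨y, ⟨hy, hyA⟩, rfl⟩
      refine ⟨(extChartAt I q).map_source (hq hyA), ?_⟩
      rw [mem_preimage, (extChartAt I q).left_inv (hq hyA)]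
      exact mem_image_of_mem _ hyA
  have hinj : InjOn (fun y => extChartAt I q (φ ((extChartAt I p).symm y)))
      ((extChartAt I p).target ∩ (extChartAt I p).symm ⁻¹' A) := by
    rintro y ⟨hy, hyA⟩ z ⟨hz, hzA⟩ h
    exact (extChartAt I p).symm.injOn hy hz
      (φ.injective ((extChartAt I q).injOn (hq hyA) (hq hzA) h))
  rw [setLIntegral_chartVolume p hA (measurable_expansionBound φ), chartVolume_apply q hφA, himage,
    lintegral_image_eq_lintegral_abs_det_fderiv_mul volume hs
      (fun y hy => (hasFDerivWithinAt_chart_read φ hy.1 (hq hy.2)).mono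
        (inter_subset_left.trans (extChartAt_target_subset_range p))) hinj]
  exact setLIntegral_mono' hs fun y hy => expansionBound_mul_chartDensity_le φ (hq hy.2)

theorem expansionBound_refl (x : M) : expansionBound (Diffeomorph.refl I M 1) x = 1 := by
  have h : mfderiv I I (Diffeomorph.refl I M 1) x = ContinuousLinearMap.id ℝ _ := mfderiv_id
  have h2 : Real.log ‖ContinuousLinearMap.id ℝ (TangentSpace I x)‖ = 0 := by
    -- On a trivial tangent space the identity has norm 0, and `Real.log 0 = 0` still gives the
    -- right value.
    rcases subsingleton_or_nontrivial (TangentSpace I x) with h' | h'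
    · have : ‖ContinuousLinearMap.id ℝ (TangentSpace I x)‖ = 0 :=
        ContinuousLinearMap.opNorm_subsingleton _
      rw [this, Real.log_zero]
    · rw [ContinuousLinearMap.norm_id, Real.log_one]
  have h3 : (mfderiv I I (Diffeomorph.refl I M 1) x).inverse =
      ContinuousLinearMap.id ℝ (TangentSpace I x) :=
    (congrArg (fun L : TangentSpace I x →L[ℝ] TangentSpace I x => L.inverse) h).trans
      ContinuousLinearMap.inverse_id
  have h4 : Real.log ‖(mfderiv I I (Diffeomorph.refl I M 1) x).inverse‖ = 0 :=
    (congrArg (fun L : TangentSpace I x →L[ℝ] TangentSpace I x => Real.log ‖L‖) h3).trans h2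
  rw [expansionBound, h4, mul_zero, neg_zero, Real.exp_zero, ENNReal.ofReal_one]

/-- The identity diffeomorphism in the previous estimate; by symmetry, chart volumes agree on
overlaps. -/
theorem chartVolume_le_of_subset_source {p q : M} {A : Set M} (hA : MeasurableSet A)
    (hp : A ⊆ (extChartAt I p).source) (hq : A ⊆ (extChartAt I q).source) :
    chartVolume I p A ≤ chartVolume I q A := by
  simpa [expansionBound_refl] using
    setLIntegral_expansionBound_chartVolume_le (Diffeomorph.refl I M 1) hA hp (by simpa using hq)

theorem riemannianVolume_apply_of_subset_source {p : M} {A : Set M} (hA : MeasurableSet A)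
    (hp : A ⊆ (extChartAt I p).source) :
    riemannianVolume I M A = chartVolume I p A := by
  have hS : MeasurableSet (extChartAt I p).source := (isOpen_extChartAt_source p).measurableSet
  refine le_antisymm ?_ (le_iSup (fun p : M => chartVolume I p) p A)
  -- The right side dominates every chart volume, hence the supremum, and its second term vanishes
  -- on subsets of the chart domain.
  have hle : riemannianVolume I M ≤
      chartVolume I p + (riemannianVolume I M).restrict (extChartAt I p).sourceᶜ := by
    refine iSup_le fun q => Measure.le_iff.2 fun B hB => ?_
    rw [Measure.add_apply, Measure.restrict_apply hB,
      ← measure_inter_add_sdiff B hS, ← sdiff_eq]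
    refine add_le_add ?_ ?_
    · have hBS := hB.inter hS
      rw [← chartVolume_inter_source q hBS, ← chartVolume_inter_source p hB]
      refine (chartVolume_le_of_subset_source
        (hBS.inter (isOpen_extChartAt_source q).measurableSet)
        (inter_subset_right) (inter_subset_left.trans inter_subset_right)).trans ?_
      exact measure_mono inter_subset_left
    · exact le_iSup (fun p : M => chartVolume I p) q _
  refine (hle A).trans_eq ?_
  rw [Measure.add_apply, Measure.restrict_apply hA,
    (disjoint_compl_right.mono_left hp).inter_eq, measure_empty, add_zero]

theorem setLIntegral_riemannianVolume_of_subset_source {p : M} {A : Set M} (hA : MeasurableSet A)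
    (hp : A ⊆ (extChartAt I p).source) (h : M → ℝ≥0∞) :
    ∫⁻ x in A, h x ∂riemannianVolume I M = ∫⁻ x in A, h x ∂chartVolume I p := by
  have : (riemannianVolume I M).restrict A = (chartVolume I p).restrict A := by
    ext B hB
    rw [Measure.restrict_apply hB, Measure.restrict_apply hB,
      riemannianVolume_apply_of_subset_source (hB.inter hA) (inter_subset_right.trans hp)]
  rw [this]

/-- Take a finite subcover and peel off one open set at a time. -/
theorem MeasureTheory.Measure.le_of_locally_le {X : Type*} [TopologicalSpace X] [CompactSpace X]
    [MeasurableSpace X] [OpensMeasurableSpace X] {μ ν : Measure X}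
    (h : ∀ x, ∃ U, IsOpen U ∧ x ∈ U ∧ ∀ A ⊆ U, MeasurableSet A → μ A ≤ ν A) : μ ≤ ν := by
  choose U hUo hxU hU using h
  obtain ⟨t, ht⟩ := isCompact_univ.elim_finite_subcover U hUo fun x _ => mem_iUnion.2 ⟨x, hxU x⟩
  have key : ∀ s : Finset X, ∀ A ⊆ ⋃ x ∈ s, U x, MeasurableSet A → μ A ≤ ν A := by
    classical
    intro s
    induction s using Finset.induction_on with
    | empty => intro A hA _; simp [subset_empty_iff.1 (by simpa using hA)]
    | insert x s _ ih =>
      intro A hA hAm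
      have hm := (hUo x).measurableSet
      rw [← measure_inter_add_sdiff A hm, ← measure_inter_add_sdiff (μ := ν) A hm]
      refine add_le_add ?_ ?_
      · exact hU x _ inter_subset_right (hAm.inter hm)
      · refine ih _ ?_ (hAm.diff hm)
        rintro y ⟨hy, hyx⟩
        simpa [hyx] using hA hy
  exact Measure.le_iff.2 fun A hA => key t A ((subset_univ A).trans ht) hA

theorem withDensity_expansionBound_le [CompactSpace M] (φ : M ≃ₘ^1⟮I, I⟯ M) :
    (riemannianVolume I M).withDensity (expansionBound φ) ≤
      (riemannianVolume I M).map φ.symm := by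
  refine Measure.le_of_locally_le fun x => ⟨(extChartAt I x).source ∩
    φ ⁻¹' (extChartAt I (φ x)).source, (isOpen_extChartAt_source x).inter
      ((isOpen_extChartAt_source (φ x)).preimage φ.continuous),
      ⟨mem_extChartAt_source x, mem_extChartAt_source (φ x)⟩, fun A hA hAm => ?_⟩
  have hφA : MeasurableSet (φ '' A) :=
    φ.toHomeomorph.measurableEmbedding.measurableSet_image.2 hAm
  have hpre : φ.symm ⁻¹' A = φ '' A := (φ.toEquiv.image_eq_preimage_symm A).symm
  rw [withDensity_apply _ hAm, Measure.map_apply φ.symm.continuous.measurable hAm, hpre,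
    setLIntegral_riemannianVolume_of_subset_source hAm (hA.trans inter_subset_left),
    riemannianVolume_apply_of_subset_source hφA
      (image_subset_iff.2 (hA.trans inter_subset_right))]
  exact setLIntegral_expansionBound_chartVolume_le φ hAm (hA.trans inter_subset_left)
    (hA.trans inter_subset_right)

theorem lintegral_expansionBound_mul_le [CompactSpace M] (φ : M ≃ₘ^1⟮I, I⟯ M) {h : M → ℝ≥0∞}
    (hh : Measurable h) :
    ∫⁻ x, expansionBound φ x * h (φ x) ∂riemannianVolume I M ≤ ∫⁻ x, h x ∂riemannianVolume I M := by
  have hφ : Measurable φ := φ.continuous.measurable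
  have h1 := lintegral_withDensity_eq_lintegral_mul (riemannianVolume I M)
    (measurable_expansionBound φ) (hh.comp hφ)
  refine h1.symm.le.trans ((lintegral_mono' (withDensity_expansionBound_le φ) le_rfl).trans ?_)
  rw [lintegral_map (hh.comp hφ) φ.symm.continuous.measurable]
  simp

/-- By compactness, local finiteness is enough: near each point the density is bounded and the chart
image lies in a unit ball. -/
theorem riemannianVolume_univ_lt_top [CompactSpace M] : riemannianVolume I M univ < ∞ := by
  refine isCompact_univ.measure_lt_top_of_nhdsWithin fun p _ => ?_
  rw [nhdsWithin_univ]
  set y₀ := extChartAt I p p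
  have hc : ContinuousAt (fun x => chartDensity I p (extChartAt I p x)) p := by
    have h1 : ContinuousOn (fun x => chartDensity I p (extChartAt I p x))
        (extChartAt I p).source :=
      (continuousOn_chartDensity p).comp (continuousOn_extChartAt p) (extChartAt I p).mapsTo
    exact h1.continuousAt (extChartAt_source_mem_nhds p)
  have hfin : chartDensity I p (extChartAt I p p) < ∞ := ENNReal.ofReal_lt_top
  obtain ⟨C, hC, hC'⟩ := exists_between hfin
  have h2 : ∀ᶠ x in 𝓝 p, x ∈ (extChartAt I p).source ∧
      chartDensity I p (extChartAt I p x) < C ∧ extChartAt I p x ∈ Metric.ball y₀ 1 :=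
    Filter.Eventually.and (extChartAt_source_mem_nhds (I := I) p) ((hc.eventually_lt_const hC).and
      ((continuousAt_extChartAt p).eventually_mem (Metric.ball_mem_nhds _ one_pos)))
  obtain ⟨U, hU, hUo, hpU⟩ := eventually_nhds_iff.1 h2
  refine ⟨U, hUo.mem_nhds hpU, ?_⟩
  have ht := (continuousOn_extChartAt_symm (I := I) p).measurableSet_inter_preimage
    (measurableSet_extChartAt_target p) hUo.measurableSet
  rw [riemannianVolume_apply_of_subset_source hUo.measurableSet fun x hx => (hU x hx).1,
    chartVolume_apply p hUo.measurableSet]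
  calc ∫⁻ y in (extChartAt I p).target ∩ (extChartAt I p).symm ⁻¹' U, chartDensity I p y
      ≤ ∫⁻ y in (extChartAt I p).target ∩ (extChartAt I p).symm ⁻¹' U, C := by
        refine setLIntegral_mono' ht fun y hy => ?_
        have := (hU _ hy.2).2.1
        rw [(extChartAt I p).right_inv hy.1] at this
        exact this.le
    _ = C * volume ((extChartAt I p).target ∩ (extChartAt I p).symm ⁻¹' U) := by
        rw [setLIntegral_const]
    _ ≤ C * volume (Metric.ball y₀ 1) := by
        gcongr
        intro y hy
        have := (hU _ hy.2).2.2
        rwa [(extChartAt I p).right_inv hy.1] at this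
    _ < ∞ := ENNReal.mul_lt_top hC' measure_ball_lt_top

/-- The density vanishes nowhere on a chart target, and the target has nonempty interior even at
boundary or corner points. -/
theorem riemannianVolume_univ_ne_zero [Nonempty M] : riemannianVolume I M univ ≠ 0 := by
  obtain ⟨p⟩ := ‹Nonempty M›
  intro h0
  have h1 : chartVolume I p univ = 0 :=
    le_antisymm ((le_iSup (fun p : M => chartVolume I p) p univ).trans h0.le) zero_le
  have ht := measurableSet_extChartAt_target (I := I) p
  rw [chartVolume_apply p MeasurableSet.univ, preimage_univ, inter_univ,
    lintegral_eq_zero_iff' ((continuousOn_chartDensity p).aemeasurable ht),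
    Filter.EventuallyEq, ae_restrict_iff' ht] at h1
  have h2 : volume (extChartAt I p).target = 0 := by
    refine measure_mono_null (t := {y | ¬ (y ∈ (extChartAt I p).target →
      chartDensity I p y = (0 : EuclideanSpace ℝ (Fin n) → ℝ≥0∞) y)}) (fun y hy hy' => ?_) h1
    have h3 := normDet_chartCoframe_mul_normDet_chartFrame p hy
    have h4 := hy' hy
    rw [chartDensity_eq_normDet, Pi.zero_apply, ENNReal.ofReal_eq_zero] at h4
    rw [le_antisymm h4 (LinearMap.normDet_nonneg _), mul_zero] at h3
    exact zero_ne_one h3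
  exact (isOpen_interior.measure_pos volume (interior_extChartAt_target_nonempty I p)).ne'
    (measure_mono_null interior_subset h2)

/-! ### Iteration along the branch and conclusion -/

theorem orbitalBranch_measurable {d : ℕ} (f : Fin d → (M ≃ₘ^1⟮I, I⟯ M)) (ω : ℕ → Fin d) (k : ℕ) :
    Measurable (orbitalBranch (fun i => (f i : M → M)) ω k) := by
  induction k with
  | zero => exact measurable_id
  | succ k ih => exact (f (ω k)).continuous.measurable.comp ih

/-- The test function `h` makes the induction work: the last factor is absorbed into it, then
removed by the one-step inequality. -/
theorem lintegral_prod_expansionBound_mul_le [CompactSpace M] {d : ℕ}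
    (f : Fin d → (M ≃ₘ^1⟮I, I⟯ M)) (ω : ℕ → Fin d) (k : ℕ) {h : M → ℝ≥0∞} (hh : Measurable h) :
    ∫⁻ x, (∏ i ∈ Finset.range k, expansionBound (f (ω i))
        (orbitalBranch (fun i => (f i : M → M)) ω i x)) *
      h (orbitalBranch (fun i => (f i : M → M)) ω k x) ∂riemannianVolume I M ≤
    ∫⁻ x, h x ∂riemannianVolume I M := by
  induction k generalizing h with
  | zero => simp [orbitalBranch]
  | succ k ih =>
    have h1 := ih ((measurable_expansionBound (f (ω k))).mul
      (hh.comp (f (ω k)).continuous.measurable))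
    refine le_trans (le_of_eq ?_) (h1.trans (lintegral_expansionBound_mul_le (f (ω k)) hh))
    simp only [Finset.prod_range_succ, orbitalBranch, Pi.mul_apply, Function.comp_apply, mul_assoc]

theorem prod_expansionBound {d : ℕ} (f : Fin d → (M ≃ₘ^1⟮I, I⟯ M)) (ω : ℕ → Fin d) (k : ℕ) (x : M) :
    ∏ i ∈ Finset.range k, expansionBound (f (ω i))
        (orbitalBranch (fun i => (f i : M → M)) ω i x) =
      ENNReal.ofReal (Real.exp (-(n * ∑ i ∈ Finset.range k,
        Real.log ‖(mfderiv I I (f (ω i)) (orbitalBranch (fun i => (f i : M → M)) ω i x)).inverse‖))) := by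
  simp only [expansionBound]
  rw [← ENNReal.ofReal_prod_of_nonneg fun _ _ => (Real.exp_pos _).le, ← Real.exp_sum,
    Finset.sum_neg_distrib, Finset.mul_sum]

/-- With `c < 0` strictly above the upper limit, eventually `u k < c * k`, so the exponent grows at
least linearly. -/
theorem tendsto_ofReal_exp_neg_of_limsup_lt {u : ℕ → ℝ} {a : ℝ} (ha : 0 < a)
    (hu : limsup (fun k : ℕ => ((1 / (k : ℝ) * u k : ℝ) : EReal)) atTop < 0) :
    Tendsto (fun k => ENNReal.ofReal (Real.exp (-(a * u k)))) atTop (𝓝 ∞) := by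
  obtain ⟨c, hc, hc0⟩ := EReal.lt_iff_exists_real_btwn.1 hu
  have hc0 : c < 0 := by exact_mod_cast hc0
  have h1 := eventually_lt_of_limsup_lt hc
  refine ENNReal.tendsto_ofReal_atTop.comp (Real.tendsto_exp_atTop.comp ?_)
  have h2 : Tendsto (fun k : ℕ => (a * -c) * (k : ℝ)) atTop atTop :=
    tendsto_natCast_atTop_atTop.const_mul_atTop (mul_pos ha (neg_pos.2 hc0))
  refine tendsto_atTop_mono' _ ?_ h2
  filter_upwards [h1, eventually_gt_atTop 0] with k hk hk0
  have hk' : 1 / (k : ℝ) * u k < c := by exact_mod_cast hk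
  have hkpos : (0 : ℝ) < k := by exact_mod_cast hk0
  rw [one_div, inv_mul_lt_iff₀ hkpos] at hk'
  nlinarith

end Volume

theorem mainTheorem7 {n : ℕ} (hn : 1 ≤ n) {H : Type*} [TopologicalSpace H]
    (I : ModelWithCorners ℝ (EuclideanSpace ℝ (Fin n)) H)
    {M : Type*} [TopologicalSpace M] [T2Space M] [CompactSpace M] [Nonempty M]
    [ChartedSpace H M] [IsManifold I 1 M]
    [RiemannianBundle (fun x : M => TangentSpace I x)]
    [IsContinuousRiemannianBundle (EuclideanSpace ℝ (Fin n)) (fun x : M => TangentSpace I x)]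
    [MeasurableSpace M] [BorelSpace M]
    {d : ℕ} (f : Fin d → (M ≃ₘ^1⟮I, I⟯ M)) :
    ¬ IsNonUniformlyExpanding I (fun i => (f i : M → M)) := by
  rintro ⟨ω, hω⟩
  have htop := riemannianVolume_univ_lt_top (I := I) (M := M)
  have hzero := riemannianVolume_univ_ne_zero (I := I) (M := M)
  -- Finite volume makes the normalizing factor nonzero, so null sets are unchanged.
  rw [normalizedLebesgue, Measure.ae_ennreal_smul_measure_eq (ENNReal.inv_ne_zero.2 htop.ne)] at hω
  let P : ℕ → M → ℝ≥0∞ := fun k x => ∏ i ∈ Finset.range k, expansionBound (f (ω i))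
        (orbitalBranch (fun i => (f i : M → M)) ω i x)
  have hP : ∀ k, Measurable (P k) := fun k => Finset.measurable_prod _ fun i _ =>
    (measurable_expansionBound (f (ω i))).comp (orbitalBranch_measurable f ω i)
  have hlim : ∀ᵐ x ∂riemannianVolume I M, liminf (fun k => P k x) atTop = ∞ := by
    filter_upwards [hω] with x hx
    refine Tendsto.liminf_eq ?_
    simp only [P, prod_expansionBound]
    -- Positive dimension is needed here: for `n = 0` the products are constantly 1.
    exact tendsto_ofReal_exp_neg_of_limsup_lt (by exact_mod_cast hn) hx
  have hfatou := lintegral_liminf_le (μ := riemannianVolume I M) (u := atTop) hP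
  rw [lintegral_congr_ae hlim, lintegral_const, ENNReal.top_mul hzero] at hfatou
  have hle : liminf (fun k => ∫⁻ x, P k x ∂riemannianVolume I M) atTop ≤
      riemannianVolume I M univ := by
    refine liminf_le_of_le (by isBoundedDefault) fun b hb => ?_
    obtain ⟨k, hk⟩ := hb.exists
    refine hk.trans ?_
    simpa using lintegral_prod_expansionBound_mul_le f ω k (h := fun _ => 1) measurable_const
  exact absurd (hfatou.trans hle) htop.not_ge
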